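/- Let $p$ be a prime. For a subgroup $G\subset \mathrm{PGL}_2(\mathbb C_p)$, a point $x\in\mathbb P^1(\mathbb C_p)$ is a \emph{limit point} of $G$ if there are pairwise different $\gamma_n\in G$ $(n\in\mathbb N)$ and $y\in\mathbb P^1(\mathbb C_p)$ with $\lim\gamma_n(y)=x$. $G$ is \emph{discontinuous} if some point of $\mathbb P^1(\mathbb C_p)$ is not a limit point of $G$ and the closure of every orbit $Gx$, $x\in\mathbb P^1(\mathbb C_p)$, is compact. $G$ is a \emph{Schottky group} if it is discontinuous, finitely generated, and has no non-trivial elements of finite order. Let $k$ be a field with $\mathbb Q_p\subset k\subset\mathbb C_p$ such that $G\subset \mathrm{PGL}_2(k)$ and such that the fixed points in $\mathbb P^1(\mathbb C_p)$ of every elliptic element of $G$ (the two eigenvalues are different and have the same absolute value) lie in $\mathbb P^1(k)$. Let $\mathcal B(k)$ be the graph whose vertices are the closed balls $B(x,r)$ with $x\in k$, $r>0$ and $r^2\in|k^\times|$, two of them being adjacent if one strictly contains the other and no admissible radius lies strictly between their radii; if $|k^\times|$ is discrete, this is the barycentric subdivision of the Bruhat-Tits tree of $k$. The group $\mathrm{PGL}_2(k)$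 acts on it by Möbius transformations (the image of a ball is its set-theoretic image if this is a ball; if instead it is the complement in $\mathbb P^1$ of an open ball, it is the closed ball with the same centre and radius as that open ball). Let $\mathcal T^*(G)\subset\mathcal B(k)$ be the induced subgraph on the vertices that lie on a line joining two different fixed points (as ends) of non-trivial elements of $G$. Here the line from $a$ to $\infty$ consists of the balls containing $a$, and the line between $a\ne b$ in $\mathbb C_p$ consists of the balls of radius at most $|a-b|$ containing $a$ or $b$. Let $\mathcal G^*(G)=\mathcal T^*(G)/G$ be the quotient graph of groups; the vertex groups at the orbit $Gv$ of a vertex $v$ of $\mathcal T^*(G)$ are the stabilizers in $G$ of the elements of $Gv$ (a conjugacy class of subgroups of $G$). \textbf{Theorem.} Let $G\subset\mathrm{PGL}_2(\mathbb C_p)$ be a finitely generated discontinuous group, let $\Gamma$ be a normal subgroup of $G$ of finite index, and let $\mathcal G^*(G)$ be constructed with any field $k$ as above. Then the following are equivalent: (i) $\Gamma$ is a Schottky group; (ii) $\Gamma\cap G_i=\{1\}$ for every vertex group $G_i$ of $\mathcal G^*(G)$. -/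

import Mathlib

open scoped LinearAlgebra.Projectivization MatrixGroups

universe u

noncomputable section

namespace PadicSchottky

section Discontinuous

variable {K : Type*} [NormedField K]

/-- The projective line over `K`. -/
abbrev P1 (K : Type*) [NormedField K] : Type _ := ℙ K (Fin 2 → K)

/-- The usual topology on the projective line: the quotient topology of `K² \ {0}`. -/
instance instTopologicalSpaceP1 : TopologicalSpace (P1 K) :=
  TopologicalSpace.coinduced (Projectivization.mk' K) inferInstance

/-- `x` is a limit point of `G` if `x = lim γ_n(y)` for some point `y` and
some pairwise different `γ_n ∈ G`. -/
def IsLimitPoint (G : Subgroup PGL(2, K)) (x : P1 K) : Prop :=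
  ∃ γ : ℕ → PGL(2, K), Function.Injective γ ∧ (∀ n, γ n ∈ G) ∧
    ∃ y : P1 K, Filter.Tendsto (fun n => γ n • y) Filter.atTop (nhds x)

/-- The set `Ω(G)` of points that are not limit points. -/
def ordinarySet (G : Subgroup PGL(2, K)) : Set (P1 K) := {x | ¬ IsLimitPoint G x}

/-- Discontinuous groups: `Ω(G)` is nonempty and all orbit closures are compact. -/
def IsDiscontinuous (G : Subgroup PGL(2, K)) : Prop :=
  (ordinarySet G).Nonempty ∧ ∀ x : P1 K, IsCompact (closure {y | ∃ g ∈ G, y = g • x})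

/-- Schottky groups: finitely generated discontinuous groups without non-trivial elements of
finite order. -/
def IsSchottky (G : Subgroup PGL(2, K)) : Prop :=
  IsDiscontinuous G ∧ G.FG ∧ ∀ g ∈ G, IsOfFinOrder g → g = 1

/-- `γ` is elliptic: the two eigenvalues of a matrix representing `γ` are different and have
the same absolute value. -/
def IsEllipticElt (γ : PGL(2, K)) : Prop :=
  ∃ A : GL (Fin 2) K, Matrix.ProjGenLinGroup.mk A = γ ∧
    ∃ a b : K, a ≠ b ∧ ‖a‖ = ‖b‖ ∧ A.val.trace = a + b ∧ A.val.det = a * b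

/-- The set `F(γ)` of fixed points of `γ` in the projective line. -/
def fixedPts (γ : PGL(2, K)) : Set (P1 K) := {x | γ • x = x}

/-- The set `F(G)` of all fixed points of non-trivial elements of `G`. -/
def fixedPtsOfGroup (G : Subgroup PGL(2, K)) : Set (P1 K) :=
  {x | ∃ γ ∈ G, γ ≠ 1 ∧ x ∈ fixedPts γ}

/-- The points of the projective line over `K` that are rational over the subfield `k`. -/
def rationalPts (k : Subfield K) : Set (P1 K) :=
  {x | ∃ (w : Fin 2 → K) (hw : w ≠ 0), (∀ i, w i ∈ k) ∧ x = Projectivization.mk K w hw}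

/-- The point `[s : 1]`. -/
def affinePt (s : K) : P1 K :=
  Projectivization.mk K ![s, 1] (fun h => one_ne_zero (congrFun h 1))

/-- The point `∞ = [1 : 0]`. -/
def inftyPt : P1 K :=
  Projectivization.mk K ![1, 0] (fun h => one_ne_zero (congrFun h 0))

end Discontinuous

section Discs

variable {K : Type*} [NormedField K] [IsUltrametricDist K]

/-- Pairs `(x, r)` standing for the closed ball `B(x, r)`. -/
abbrev PreDisc (K : Type*) : Type _ := K × {r : ℝ // 0 < r}

/-- Two pairs describe the same ball if the radii agree and each centre lies in the other ball. -/
instance discSetoid (K : Type*) [NormedField K] [IsUltrametricDist K] : Setoid (PreDisc K) where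
  r P Q := P.2 = Q.2 ∧ ‖P.1 - Q.1‖ ≤ P.2.1
  iseqv :=
    { refl := fun P => ⟨rfl, by simpa using P.2.2.le⟩
      symm := fun {P Q} (h : P.2 = Q.2 ∧ ‖P.1 - Q.1‖ ≤ P.2.1) =>
        ⟨h.1.symm, by rw [norm_sub_rev, ← h.1]; exact h.2⟩
      trans := fun {P Q R} (h : P.2 = Q.2 ∧ ‖P.1 - Q.1‖ ≤ P.2.1)
          (h' : Q.2 = R.2 ∧ ‖Q.1 - R.1‖ ≤ Q.2.1) => ⟨h.1.trans h'.1, by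
        have h2 : ‖Q.1 - R.1‖ ≤ P.2.1 := by rw [h.1]; exact h'.2
        calc ‖P.1 - R.1‖ = ‖(P.1 - Q.1) + (Q.1 - R.1)‖ := by rw [sub_add_sub_cancel]
          _ ≤ max ‖P.1 - Q.1‖ ‖Q.1 - R.1‖ := IsUltrametricDist.norm_add_le_max _ _
          _ ≤ P.2.1 := max_le h.2 h2⟩ }

/-- Closed balls `B(x, r)` in `K` with a centre in `K` and a radius `r > 0`. -/
def Disc (K : Type*) [NormedField K] [IsUltrametricDist K] : Type _ := Quotient (discSetoid K)

/-- The ball `B(x, r)`. -/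
def Disc.mk (x : K) (r : {r : ℝ // 0 < r}) : Disc K := Quotient.mk (discSetoid K) (x, r)

/-- The radius of a ball. -/
def Disc.radius (D : Disc K) : ℝ := Quotient.lift (fun P : PreDisc K => P.2.1)
  (fun P Q (h : P.2 = Q.2 ∧ ‖P.1 - Q.1‖ ≤ P.2.1) => congrArg Subtype.val h.1) D

/-- The underlying set of a ball. -/
def Disc.carrier (D : Disc K) : Set K :=
  {y | ∃ r : {r : ℝ // 0 < r}, D = Disc.mk y r}

lemma Disc.carrier_mk (x : K) (r : {r : ℝ // 0 < r}) :
    (Disc.mk x r).carrier = Metric.closedBall x r := by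
  ext y
  simp only [Disc.carrier, Set.mem_ofPred_eq, Metric.mem_closedBall, dist_eq_norm]
  constructor
  · rintro ⟨s, hs⟩
    have h := Quotient.exact hs
    rw [norm_sub_rev]; exact h.2
  · intro h
    exact ⟨r, Quotient.sound ⟨rfl, by rw [norm_sub_rev]; exact h⟩⟩

open Classical in
/-- The image of `B(x, r)` under the Möbius transformation with matrix `(a b; c d)`.
If the pole `-d/c` is not in `B(x, r)`, it is the set-theoretic image, the ball around
`(ax+b)/(cx+d)` of radius `r |ad-bc| / |cx+d|²`. Otherwise the set-theoretic image is the
complement of the open ball around `a/c` of radius `|ad-bc| / (|c|² r)`, and the closed ball with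
this centre and radius is taken. -/
def moebius (g : GL (Fin 2) K) (P : PreDisc K) : PreDisc K :=
  if h : ‖g 1 0‖ * P.2.1 < ‖g 1 0 * P.1 + g 1 1‖ then
    ((g 0 0 * P.1 + g 0 1) / (g 1 0 * P.1 + g 1 1),
      ⟨P.2.1 * ‖g.val.det‖ / ‖g 1 0 * P.1 + g 1 1‖ ^ 2, by
        have h1 : 0 < ‖g 1 0 * P.1 + g 1 1‖ :=
          lt_of_le_of_lt (mul_nonneg (norm_nonneg _) P.2.2.le) h
        have h2 : 0 < ‖g.val.det‖ := norm_pos_iff.2 g.det_ne_zero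
        have h3 := P.2.2
        positivity⟩)
  else
    (g 0 0 / g 1 0,
      ⟨‖g.val.det‖ / (‖g 1 0‖ ^ 2 * P.2.1), by
        have h2 : 0 < ‖g.val.det‖ := norm_pos_iff.2 g.det_ne_zero
        have h3 := P.2.2
        have h1 : 0 < ‖g 1 0‖ := by
          rw [norm_pos_iff]
          intro h0
          have h4 : g 1 1 = 0 := by simpa [h0] using h
          apply g.det_ne_zero
          rw [Matrix.det_fin_two, h0, h4]
          simp
        positivity⟩)

/-- The norm on `K²` attached to a ball; auxiliary, it shows that `moebius` is a group action. -/
def discNorm (P : PreDisc K) (u : Fin 2 → K) : ℝ := max ‖u 0 - P.1 * u 1‖ (P.2.1 * ‖u 1‖)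

lemma max_shift {x y : K} {s A : ℝ} (hs : 0 ≤ s) (h : s * ‖x‖ ≤ A) :
    max A (s * ‖x + y‖) = max A (s * ‖y‖) := by
  apply le_antisymm
  · refine max_le (le_max_left _ _) ?_
    rcases le_max_iff.1 (IsUltrametricDist.norm_add_le_max x y) with h1 | h1
    · exact le_max_of_le_left ((mul_le_mul_of_nonneg_left h1 hs).trans h)
    · exact le_max_of_le_right (mul_le_mul_of_nonneg_left h1 hs)
  · refine max_le (le_max_left _ _) ?_
    have h0 : ‖y‖ ≤ max ‖x + y‖ ‖x‖ := by
      calc ‖y‖ = ‖(x + y) + -x‖ := by rw [← sub_eq_add_neg, add_sub_cancel_left]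
        _ ≤ max ‖x + y‖ ‖-x‖ := IsUltrametricDist.norm_add_le_max _ _
        _ = max ‖x + y‖ ‖x‖ := by rw [norm_neg]
    rcases le_max_iff.1 h0 with h1 | h1
    · exact le_max_of_le_right (mul_le_mul_of_nonneg_left h1 hs)
    · exact le_max_of_le_left ((mul_le_mul_of_nonneg_left h1 hs).trans h)

lemma discNorm_moebius (g : GL (Fin 2) K) (P : PreDisc K) :
    ∃ c : ℝ, 0 < c ∧ ∀ u, discNorm (moebius g P) (g.val.mulVec u) = c * discNorm P u := by
  obtain ⟨x, r, hr⟩ := P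
  have he : 0 < ‖g.val.det‖ := norm_pos_iff.2 g.det_ne_zero
  have hdet := Matrix.det_fin_two g.val
  by_cases h : ‖g 1 0‖ * r < ‖g 1 0 * x + g 1 1‖
  · have hm : 0 < ‖g 1 0 * x + g 1 1‖ := lt_of_le_of_lt (mul_nonneg (norm_nonneg _) hr.le) h
    have hm0 := norm_pos_iff.1 hm
    refine ⟨‖g.val.det‖ / ‖g 1 0 * x + g 1 1‖, by positivity, fun u => ?_⟩
    have hmv0 : (g.val.mulVec u) 0 = g 0 0 * u 0 + g 0 1 * u 1 := by simp
    have hmv1 : (g.val.mulVec u) 1 = g 1 0 * u 0 + g 1 1 * u 1 := by simp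
    have e1 : (g.val.mulVec u) 0
        - (g 0 0 * x + g 0 1) / (g 1 0 * x + g 1 1) * (g.val.mulVec u) 1
        = g.val.det / (g 1 0 * x + g 1 1) * (u 0 - x * u 1) := by
      rw [hdet, hmv0, hmv1, div_mul_eq_mul_div, div_mul_eq_mul_div, sub_eq_iff_eq_add,
        ← add_div, eq_div_iff hm0]
      ring
    have e2 : (g.val.mulVec u) 1 = g 1 0 * (u 0 - x * u 1) + (g 1 0 * x + g 1 1) * u 1 := by
      rw [hmv1]
      ring
    simp only [discNorm, moebius, dif_pos h]
    rw [e1, e2, norm_mul, norm_div]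
    rw [show r * ‖g.val.det‖ / ‖g 1 0 * x + g 1 1‖ ^ 2
      * ‖g 1 0 * (u 0 - x * u 1) + (g 1 0 * x + g 1 1) * u 1‖
      = ‖g.val.det‖ / ‖g 1 0 * x + g 1 1‖ * (r / ‖g 1 0 * x + g 1 1‖
      * ‖g 1 0 * (u 0 - x * u 1) + (g 1 0 * x + g 1 1) * u 1‖) by field_simp]
    rw [← mul_max_of_nonneg _ _ (by positivity)]
    congr 1
    rw [max_shift (by positivity)]
    · congr 1
      rw [norm_mul]
      field_simp
    · rw [norm_mul]
      rw [show r / ‖g 1 0 * x + g 1 1‖ * (‖g 1 0‖ * ‖u 0 - x * u 1‖)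
        = (‖g 1 0‖ * r / ‖g 1 0 * x + g 1 1‖) * ‖u 0 - x * u 1‖ by ring]
      exact mul_le_of_le_one_left (norm_nonneg _) ((div_le_one hm).2 h.le)
  · have hc : g 1 0 ≠ 0 := by
      intro h0
      have h4 : g 1 1 = 0 := by simpa [h0] using h
      apply g.det_ne_zero
      rw [Matrix.det_fin_two, h0, h4]
      simp
    have hc' : 0 < ‖g 1 0‖ := norm_pos_iff.2 hc
    refine ⟨‖g.val.det‖ / (‖g 1 0‖ * r), by positivity, fun u => ?_⟩
    have hmv0 : (g.val.mulVec u) 0 = g 0 0 * u 0 + g 0 1 * u 1 := by simp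
    have hmv1 : (g.val.mulVec u) 1 = g 1 0 * u 0 + g 1 1 * u 1 := by simp
    have e1 : (g.val.mulVec u) 0 - g 0 0 / g 1 0 * (g.val.mulVec u) 1
        = -(g.val.det / g 1 0 * u 1) := by
      rw [hdet, hmv0, hmv1]
      field_simp
      ring
    have e2 : (g.val.mulVec u) 1
        = g 1 0 * (((g 1 0 * x + g 1 1) / g 1 0) * u 1 + (u 0 - x * u 1)) := by
      rw [hmv1]
      field_simp
      ring
    simp only [discNorm, moebius, dif_neg h]
    rw [e1, e2, norm_neg, norm_mul, norm_mul, norm_div]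
    rw [show ‖g.val.det‖ / ‖g 1 0‖ * ‖u 1‖
      = ‖g.val.det‖ / (‖g 1 0‖ * r) * (r * ‖u 1‖) by field_simp]
    rw [show ∀ t : ℝ, ‖g.val.det‖ / (‖g 1 0‖ ^ 2 * r) * (‖g 1 0‖ * t)
      = ‖g.val.det‖ / (‖g 1 0‖ * r) * (1 * t) by intro t; field_simp]
    rw [← mul_max_of_nonneg _ _ (by positivity)]
    congr 1
    rw [max_shift zero_le_one, one_mul, max_comm]
    rw [one_mul, norm_mul, norm_div]
    apply mul_le_mul_of_nonneg_right _ (norm_nonneg _)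
    rw [div_le_iff₀ hc', mul_comm r]
    exact not_lt.1 h

lemma discNorm_congr {P Q : PreDisc K} (h : P ≈ Q) : discNorm P = discNorm Q := by
  obtain ⟨x, r, hr⟩ := P
  obtain ⟨y, s, hs⟩ := Q
  obtain ⟨h1, h2⟩ := h
  obtain rfl : r = s := congrArg Subtype.val h1
  funext u
  simp only [discNorm]
  have e : u 0 - x * u 1 = (u 0 - y * u 1) + (y - x) * u 1 := by ring
  rw [e, max_comm, max_comm _ (r * ‖u 1‖)]
  have := max_shift (K := K) (x := (y - x) * u 1) (y := u 0 - y * u 1) (s := 1)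
    (A := r * ‖u 1‖) zero_le_one (by
      rw [one_mul, norm_mul, norm_sub_rev]
      exact mul_le_mul_of_nonneg_right h2 (norm_nonneg _))
  rw [one_mul, one_mul, add_comm] at this
  exact this

lemma equiv_of_discNorm {P Q : PreDisc K} {c : ℝ}
    (h : ∀ u, discNorm P u = c * discNorm Q u) : P ≈ Q := by
  obtain ⟨x, r, hr⟩ := P
  obtain ⟨y, s, hs⟩ := Q
  have hc : c = 1 := by simpa [discNorm] using (h ![1, 0]).symm
  subst hc
  have h1 := h ![x, 1]
  have h2 := h ![y, 1]
  simp only [discNorm, Matrix.cons_val_zero, Matrix.cons_val_one, mul_one, norm_one, sub_self,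
    norm_zero, one_mul, max_eq_right hr.le, max_eq_right hs.le] at h1 h2
  have h3 : s ≤ r := by rw [h1]; exact le_max_right _ _
  have h4 : r ≤ s := (le_max_right _ _).trans h2.le
  obtain rfl : r = s := le_antisymm h4 h3
  refine ⟨rfl, ?_⟩
  change ‖x - y‖ ≤ r
  rw [h1]
  exact le_max_left _ _

lemma moebius_congr (g : GL (Fin 2) K) {P Q : PreDisc K} (h : P ≈ Q) :
    moebius g P ≈ moebius g Q := by
  obtain ⟨c, hc, h1⟩ := discNorm_moebius g P
  obtain ⟨d, hd, h2⟩ := discNorm_moebius g Q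
  apply equiv_of_discNorm (c := c / d)
  intro u
  have hu : u = g.val.mulVec ((g⁻¹).val.mulVec u) := by
    rw [Matrix.mulVec_mulVec, ← Units.val_mul, mul_inv_cancel]; simp
  rw [hu, h1, h2, discNorm_congr h]
  field_simp

/-- `GL₂(K)` acts on balls by Möbius transformations. -/
instance instActionGL : MulAction (GL (Fin 2) K) (Disc K) where
  smul g := Quotient.map (moebius g) (fun _ _ h => moebius_congr g h)
  one_smul D := by
    induction D using Quotient.inductionOn with | _ P =>
    apply Quotient.sound
    obtain ⟨c, hc, h⟩ := discNorm_moebius 1 P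
    exact equiv_of_discNorm (c := c) (fun u => by simpa using h u)
  mul_smul g g' D := by
    induction D using Quotient.inductionOn with | _ P =>
    apply Quotient.sound
    obtain ⟨c, hc, h⟩ := discNorm_moebius (g * g') P
    obtain ⟨c1, hc1, h1⟩ := discNorm_moebius g' P
    obtain ⟨c2, hc2, h2⟩ := discNorm_moebius g (moebius g' P)
    apply equiv_of_discNorm (c := c / (c2 * c1))
    intro u
    have hu : u = (g * g').val.mulVec ((g * g')⁻¹.val.mulVec u) := by
      rw [Matrix.mulVec_mulVec, ← Units.val_mul, mul_inv_cancel]; simp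
    have h3 : ∀ w, (g * g').val.mulVec w = g.val.mulVec (g'.val.mulVec w) := by
      intro w; rw [Matrix.mulVec_mulVec, Units.val_mul]
    rw [hu, h]
    rw [h3 ((g * g')⁻¹.val.mulVec u), h2, h1]
    field_simp

/-- The induced action of `PGL₂(K)` on balls. -/
instance instActionPGL : MulAction PGL(2, K) (Disc K) :=
  Matrix.ProjGenLinGroup.mulActionOfGL fun a D => by
    induction D using Quotient.inductionOn with | _ P =>
    apply Quotient.sound
    obtain ⟨c, hc, h⟩ := discNorm_moebius (Matrix.GeneralLinearGroup.scalar (Fin 2) a) P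
    have ha : 0 < ‖(a : K)‖ := norm_pos_iff.2 a.ne_zero
    apply equiv_of_discNorm (c := c / ‖(a : K)‖)
    intro u
    have hs : ∀ w : Fin 2 → K,
        (Matrix.GeneralLinearGroup.scalar (Fin 2) a).val.mulVec w = (a : K) • w := by
      intro w
      ext i
      fin_cases i <;> simp
    have hn : ∀ (Q : PreDisc K) (w : Fin 2 → K),
        discNorm Q ((a : K) • w) = ‖(a : K)‖ * discNorm Q w := by
      intro Q w
      simp only [discNorm, Pi.smul_apply, smul_eq_mul]
      rw [mul_max_of_nonneg _ _ (norm_nonneg _), ← norm_mul, norm_mul (a : K) (w 1)]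
      congr 1
      · congr 1; ring
      · ring
    have h' := h u
    rw [hs, hn] at h'
    field_simp
    linarith

/-- The values `r > 0` with `r² ∈ |kˣ|`. -/
def radii (k : Subfield K) : Set ℝ := {r | 0 < r ∧ ∃ c ∈ k, c ≠ 0 ∧ r ^ 2 = ‖c‖}

/-- The vertices of the Bruhat-Tits tree of the subfield `k`, already subdivided so that `PGL₂(k)`
acts without inversions: the balls with a centre in `k` and a radius in `|kˣ|` are the original
vertices, the ones whose radius is only the square root of an element of `|kˣ|` are the midpoints
of the original edges (when `|kˣ|` is discrete). A ball in `k` is represented by the ball in `K`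
with the same centre and radius. -/
def bruhatTitsVertices (k : Subfield K) : Set (Disc K) :=
  {D | D.radius ∈ radii k ∧ ∃ x ∈ k, x ∈ D.carrier}

/-- The subdivided Bruhat-Tits tree of `k`: two vertices are joined by an edge if one contains the
other and no admissible radius lies strictly between their radii. -/
def bruhatTitsTree (k : Subfield K) : SimpleGraph (Disc K) :=
  SimpleGraph.fromRel fun D E => D ∈ bruhatTitsVertices k ∧ E ∈ bruhatTitsVertices k ∧
    D.carrier ⊆ E.carrier ∧ D.radius < E.radius ∧
    ∀ s ∈ radii k, ¬ (D.radius < s ∧ s < E.radius)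

/-- The balls on the line that joins the ends belonging to two different points of the projective
line. The end of `s ∈ K` is given by the balls `B(s, r)` for `r → 0`, the end of `∞` by the balls
`B(s, r)` for `r → ∞`. -/
def line (a b : P1 K) : Set (Disc K) :=
  {D | (∃ s t : K, a = affinePt s ∧ b = affinePt t ∧
          (s ∈ D.carrier ∨ t ∈ D.carrier) ∧ D.radius ≤ ‖s - t‖) ∨
       (∃ s : K, ((a = affinePt s ∧ b = inftyPt) ∨ (a = inftyPt ∧ b = affinePt s)) ∧
          s ∈ D.carrier)}

/-- The vertices of `T*(G)`. -/
def treeVertices (k : Subfield K) (G : Subgroup PGL(2, K)) : Set (Disc K) :=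
  {D | D ∈ bruhatTitsVertices k ∧
    ∃ a ∈ fixedPtsOfGroup G, ∃ b ∈ fixedPtsOfGroup G, a ≠ b ∧ D ∈ line a b}

/-- `T*(G)`: the subtree of the Bruhat-Tits tree of `k` generated by the ends that belong
to the fixed points of `G`, i.e. the union of the lines between such ends. -/
def fixedPointTree (k : Subfield K) (G : Subgroup PGL(2, K)) :
    (bruhatTitsTree k).Subgraph :=
  (⊤ : (bruhatTitsTree k).Subgraph).induce (treeVertices k G)

/-- Graphs in the sense of Serre (edges are oriented and come with their inverses) whose vertices
and edges are labelled by classes of subgroups of an ambient group. -/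
structure LabelledGraph (H : Type*) [Group H] where
  Vertex : Type u
  Edge : Type u
  origin : Edge → Vertex
  terminus : Edge → Vertex
  inverse : Edge → Edge
  vertexGroups : Vertex → Set (Subgroup H)
  edgeGroups : Edge → Set (Subgroup H)

/-- `𝒢*(G)`: the quotient of `T*(G)` by `G`. Its vertices and edges are the `G`-orbits of vertices
and oriented edges of `T*(G)`, and each is labelled by the conjugacy class in `G` formed by the
stabilizers in `G` of the elements of the orbit. -/
def quotientGraph (k : Subfield K) (G : Subgroup PGL(2, K)) :
    LabelledGraph PGL(2, K) where
  Vertex := {X : MulAction.orbitRel.Quotient G (Disc K) //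
    ∃ v ∈ (fixedPointTree k G).verts, Quotient.mk _ v = X}
  Edge := {X : MulAction.orbitRel.Quotient G (Disc K × Disc K) //
    ∃ e : Disc K × Disc K, (fixedPointTree k G).Adj e.1 e.2 ∧ Quotient.mk _ e = X}
  origin X := ⟨Quotient.map' Prod.fst (by
      rintro _ e ⟨g, rfl⟩; exact ⟨g, rfl⟩) X.1, by
    obtain ⟨_, e, he, rfl⟩ := X
    exact ⟨e.1, he.fst_mem, rfl⟩⟩
  terminus X := ⟨Quotient.map' Prod.snd (by
      rintro _ e ⟨g, rfl⟩; exact ⟨g, rfl⟩) X.1, by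
    obtain ⟨_, e, he, rfl⟩ := X
    exact ⟨e.2, he.snd_mem, rfl⟩⟩
  inverse X := ⟨Quotient.map' Prod.swap (by
      rintro _ e ⟨g, rfl⟩; exact ⟨g, rfl⟩) X.1, by
    obtain ⟨_, e, he, rfl⟩ := X
    exact ⟨e.swap, he.symm, rfl⟩⟩
  vertexGroups X := {S | ∃ v ∈ (fixedPointTree k G).verts,
    Quotient.mk _ v = X.1 ∧ S = G ⊓ MulAction.stabilizer PGL(2, K) v}
  edgeGroups X := {S | ∃ e : Disc K × Disc K, (fixedPointTree k G).Adj e.1 e.2 ∧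
    Quotient.mk _ e = X.1 ∧ S = G ⊓ MulAction.stabilizer PGL(2, K) e}

/-- `k` is a field of definition for the construction of `𝒢*(G)`: all elements of `G` can be
represented by matrices over `k`, and the fixed points of the elliptic elements of `G` are
rational over `k`. -/
def IsFieldOfDefinition (k : Subfield K) (G : Subgroup PGL(2, K)) : Prop :=
  G ≤ (Matrix.ProjGenLinGroup.map (n := Fin 2) k.subtype).range ∧
    ∀ γ ∈ G, IsEllipticElt γ → fixedPts γ ⊆ rationalPts k

end Discs

end PadicSchottky

end

/-!
A ball `B(x, r)` is the same as the class, up to scaling, of the norm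
`u ↦ max |u₀ - x u₁| (r |u₁|)` on `K²` (`discNorm`), and a matrix stabilizes the ball exactly when
it is a similitude of this norm (`smul_mk_eq_iff`). Both implications rest on this description.

If `γ` stabilizes a ball, it is an isometry of the chordal distance
`|det (u, w)| / (N u * N w)` of the corresponding norm `N` (`chordal_smul_smul`), and this distance
induces the topology of the projective line. If moreover `γ` lies in a discontinuous group, the
closure of the orbit of any point `x` is compact, so two of the points `γⁿ x` are close to each
other, and as `γ` is an isometry, some positive power of `γ` moves `x` only a little
(`exists_pow_chordal_lt`). Were `γ` of infinite order, every `x` would thus be a limit point, whereas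
`Ω(G)` is non-empty. Hence elements of `G` that stabilize a ball have finite order
(`IsDiscontinuous.isOfFinOrder_of_smul_eq`), and a torsion-free `Γ` meets the vertex groups
trivially.

Conversely, in characteristic zero a non-trivial element of finite order is diagonalizable, with two
different eigenvalues whose quotient is a root of unity; so it is elliptic
(`exists_eigenvalues_of_isOfFinOrder`). Its two fixed points are rational over `k` by the choice of
`k`, and it stabilizes a ball of `B(k)` on the line between them, because the eigenvectors are
orthogonal for the norm of that ball (`exists_mem_line_smul_eq`). This ball is a vertex of `T*(G)`,
so `Γ` is torsion-free once it meets all vertex groups trivially. Discontinuity passes to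
subgroups, and finite generation to subgroups of finite index.
-/

namespace PadicSchottky

/-! ### The chordal distance attached to a ball -/

section NormedField

variable {K : Type*} [NormedField K]

lemma discNorm_smul (P : PreDisc K) (a : K) (u : Fin 2 → K) :
    discNorm P (a • u) = ‖a‖ * discNorm P u := by
  simp only [discNorm, Pi.smul_apply, smul_eq_mul]
  rw [mul_max_of_nonneg _ _ (norm_nonneg _), ← norm_mul, norm_mul a (u 1)]
  congr 1
  · congr 1; ring
  · ring

lemma discNorm_pos (P : PreDisc K) {u : Fin 2 → K} (hu : u ≠ 0) : 0 < discNorm P u := by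
  by_cases h1 : u 1 = 0
  · have h0 : u 0 ≠ 0 := fun h0 => hu (by ext i; fin_cases i <;> simpa)
    exact lt_max_of_lt_left (by simpa [h1] using h0)
  · exact lt_max_of_lt_right (mul_pos P.2.2 (norm_pos_iff.2 h1))

lemma continuous_discNorm (P : PreDisc K) : Continuous (discNorm P) := by
  unfold discNorm
  fun_prop

/-- The determinant of the `2 × 2` matrix with rows `u` and `w`. -/
def cross (u w : Fin 2 → K) : K := u 0 * w 1 - u 1 * w 0

lemma cross_mulVec (A : Matrix (Fin 2) (Fin 2) K) (u w : Fin 2 → K) :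
    cross (A.mulVec u) (A.mulVec w) = A.det * cross u w := by
  simp only [cross, Matrix.det_fin_two, Matrix.mulVec, dotProduct, Fin.sum_univ_two]
  ring

/-- Cramer's rule for three vectors of the plane. -/
lemma cross_smul_eq (u v w : Fin 2 → K) :
    cross u v • w = cross u w • v + cross w v • u := by
  ext i
  fin_cases i <;> simp [cross] <;> ring

lemma exists_cross_ne_zero {u : Fin 2 → K} (hu : u ≠ 0) : ∃ w, cross u w ≠ 0 := by
  by_contra! h
  refine hu ?_
  ext i
  fin_cases i
  · simpa [cross] using h ![0, 1]
  · simpa [cross] using h ![1, 0]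

/-- The chordal distance on the projective line for the norm of the ball `P`. -/
noncomputable def chordal (P : PreDisc K) (x y : P1 K) : ℝ :=
  ‖cross x.rep y.rep‖ / (discNorm P x.rep * discNorm P y.rep)

lemma chordal_mk (P : PreDisc K) {u w : Fin 2 → K} (hu : u ≠ 0) (hw : w ≠ 0) :
    chordal P (Projectivization.mk K u hu) (Projectivization.mk K w hw) =
      ‖cross u w‖ / (discNorm P u * discNorm P w) := by
  obtain ⟨a, ha⟩ := Projectivization.exists_smul_eq_mk_rep K u hu
  obtain ⟨b, hb⟩ := Projectivization.exists_smul_eq_mk_rep K w hw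
  have ha0 : 0 < ‖(a : K)‖ := norm_pos_iff.2 a.ne_zero
  have hb0 : 0 < ‖(b : K)‖ := norm_pos_iff.2 b.ne_zero
  have h1 := discNorm_pos P hu
  have h2 := discNorm_pos P hw
  rw [chordal, ← ha, ← hb, Units.smul_def, Units.smul_def, discNorm_smul, discNorm_smul,
    show cross ((a : K) • u) ((b : K) • w) = a * b * cross u w by
      simp only [cross, Pi.smul_apply, smul_eq_mul]; ring, norm_mul, norm_mul]
  field_simp

lemma chordal_self (P : PreDisc K) (x : P1 K) : chordal P x x = 0 := by
  simp [chordal, cross, mul_comm]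

lemma isOpen_chordal_lt (P : PreDisc K) (x : P1 K) (ε : ℝ) : IsOpen {y | chordal P x y < ε} := by
  refine isOpen_coinduced.2 ?_
  induction x using Projectivization.ind with | _ u hu =>
  have h : Projectivization.mk' K ⁻¹' {y | chordal P (Projectivization.mk K u hu) y < ε} =
      {w : {w : Fin 2 → K // w ≠ 0} |
        ‖cross u w.1‖ / (discNorm P u * discNorm P w.1) < ε} := by
    ext w
    change chordal P _ (Projectivization.mk K w.1 w.2) < ε ↔ _
    rw [chordal_mk]
    rfl
  rw [h]
  refine isOpen_lt ?_ continuous_const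
  refine Continuous.div ?_ ?_ fun w =>
    (mul_pos (discNorm_pos P hu) (discNorm_pos P w.2)).ne'
  · have h0 : ∀ i, Continuous fun w : {w : Fin 2 → K // w ≠ 0} => w.1 i := fun i =>
      (continuous_apply i).comp continuous_subtype_val
    exact ((continuous_const.mul (h0 1)).sub (continuous_const.mul (h0 0))).norm
  · exact continuous_const.mul ((continuous_discNorm P).comp continuous_subtype_val)

end NormedField

section Ultrametric

variable {K : Type*} [NormedField K] [IsUltrametricDist K]

lemma discNorm_add_le (P : PreDisc K) (u w : Fin 2 → K) :
    discNorm P (u + w) ≤ max (discNorm P u) (discNorm P w) := by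
  have hP := P.2.2.le
  refine max_le ?_ ?_
  · rw [show (u + w) 0 - P.1 * (u + w) 1 = (u 0 - P.1 * u 1) + (w 0 - P.1 * w 1) by
      simp only [Pi.add_apply]; ring]
    exact (IsUltrametricDist.norm_add_le_max _ _).trans
      (max_le_max (le_max_left _ _) (le_max_left _ _))
  · refine (mul_le_mul_of_nonneg_left (IsUltrametricDist.norm_add_le_max (u 1) (w 1)) hP).trans ?_
    rw [mul_max_of_nonneg _ _ hP]
    exact max_le_max (le_max_right _ _) (le_max_right _ _)

lemma norm_cross_le (P : PreDisc K) (u w : Fin 2 → K) :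
    P.2.1 * ‖cross u w‖ ≤ discNorm P u * discNorm P w := by
  have hP := P.2.2.le
  have hu : 0 ≤ discNorm P u := le_max_of_le_left (norm_nonneg _)
  rw [show cross u w = (u 0 - P.1 * u 1) * w 1 + -(u 1 * (w 0 - P.1 * w 1)) by
    simp only [cross]; ring]
  refine (mul_le_mul_of_nonneg_left (IsUltrametricDist.norm_add_le_max _ _) hP).trans ?_
  rw [mul_max_of_nonneg _ _ hP, norm_neg, norm_mul, norm_mul]
  refine max_le ?_ ?_
  · rw [mul_left_comm]
    exact mul_le_mul (le_max_left _ _) (le_max_right _ _) (mul_nonneg hP (norm_nonneg _)) hu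
  · rw [← mul_assoc]
    exact mul_le_mul (le_max_right _ _) (le_max_left _ _) (norm_nonneg _) hu

/-- A matrix stabilizes a ball exactly when it is a similitude for the norm of that ball. -/
lemma smul_mk_eq_iff (g : GL (Fin 2) K) (P : PreDisc K) :
    Matrix.ProjGenLinGroup.mk g • Disc.mk P.1 P.2 = Disc.mk P.1 P.2 ↔
      ∃ c : ℝ, 0 < c ∧ ∀ u, discNorm P (g.val.mulVec u) = c * discNorm P u := by
  have key : Matrix.ProjGenLinGroup.mk g • Disc.mk P.1 P.2 = Disc.mk P.1 P.2 ↔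
      moebius g P ≈ P := Quotient.eq (r := discSetoid K)
  rw [key]
  obtain ⟨c, hc, h⟩ := discNorm_moebius g P
  constructor
  · intro hP
    exact ⟨c, hc, fun u => by rw [← h u, discNorm_congr hP]⟩
  · rintro ⟨d, hd, h'⟩
    refine equiv_of_discNorm (c := c / d) fun u => ?_
    have hu : u = g.val.mulVec ((g⁻¹).val.mulVec u) := by
      rw [Matrix.mulVec_mulVec, ← Units.val_mul, mul_inv_cancel]; simp
    rw [hu, h, h']
    field_simp

lemma norm_det_le_of_similitude (P : PreDisc K) (A : Matrix (Fin 2) (Fin 2) K) {c : ℝ}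
    (h : ∀ u, discNorm P (A.mulVec u) = c * discNorm P u) : ‖A.det‖ ≤ c ^ 2 := by
  have hP := P.2.2
  -- `norm_cross_le` is an equality for this pair of vectors
  have h1 := norm_cross_le P (A.mulVec ![1, 0]) (A.mulVec ![P.1, 1])
  rw [cross_mulVec, h, h] at h1
  have e1 : discNorm P ![1, 0] = 1 := by simp [discNorm]
  have e2 : discNorm P ![P.1, 1] = P.2.1 := by simp [discNorm, hP.le]
  have e3 : cross ![1, 0] ![P.1, 1] = (1 : K) := by simp [cross]
  rw [e1, e2, e3, mul_one, mul_one] at h1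
  exact le_of_mul_le_mul_left (h1.trans_eq (by ring)) hP

lemma norm_det_of_similitude (P : PreDisc K) (g : GL (Fin 2) K) {c : ℝ} (hc : 0 < c)
    (h : ∀ u, discNorm P (g.val.mulVec u) = c * discNorm P u) : ‖g.val.det‖ = c ^ 2 := by
  refine le_antisymm (norm_det_le_of_similitude P _ h) ?_
  have h' : ∀ u, discNorm P ((g⁻¹).val.mulVec u) = c⁻¹ * discNorm P u := fun u => by
    have h1 := h ((g⁻¹).val.mulVec u)
    rw [Matrix.mulVec_mulVec, ← Units.val_mul, mul_inv_cancel, Units.val_one,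
      Matrix.one_mulVec] at h1
    rw [h1]
    field_simp
  have h2 := norm_det_le_of_similitude P _ h'
  have h3 : ‖g.val.det‖ * ‖(g⁻¹).val.det‖ = 1 := by
    rw [← norm_mul, ← Matrix.det_mul, ← Units.val_mul, mul_inv_cancel]; simp
  have h4 : 1 ≤ ‖g.val.det‖ * c⁻¹ ^ 2 :=
    h3.symm.le.trans (mul_le_mul_of_nonneg_left h2 (norm_nonneg _))
  rwa [inv_pow, ← div_eq_mul_inv, one_le_div (by positivity)] at h4

/-- The strong triangle inequality, from Cramer's rule and that of the norm. -/
lemma chordal_le_max (P : PreDisc K) (x y z : P1 K) :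
    chordal P y z ≤ max (chordal P x y) (chordal P x z) := by
  have hx := discNorm_pos P x.rep_nonzero
  have hy := discNorm_pos P y.rep_nonzero
  have hz := discNorm_pos P z.rep_nonzero
  simp only [chordal]
  set u := x.rep
  set v := y.rep
  set w := z.rep
  have h := discNorm_add_le P (cross u w • v) (-cross u v • w)
  rw [show cross u w • v + -cross u v • w = cross v w • u by
      rw [neg_smul, cross_smul_eq u v w,
        show cross w v = -cross v w by simp only [cross]; ring, neg_smul]; abel,
    discNorm_smul, discNorm_smul, discNorm_smul, norm_neg] at h
  rcases le_max_iff.1 h with h | h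
  · refine le_max_of_le_right ?_
    rw [div_le_div_iff₀ (by positivity) (by positivity)]
    nlinarith [mul_le_mul_of_nonneg_right h hz.le]
  · refine le_max_of_le_left ?_
    rw [div_le_div_iff₀ (by positivity) (by positivity)]
    nlinarith [mul_le_mul_of_nonneg_right h hy.le]

lemma chordal_smul_smul {P : PreDisc K} {γ : PGL(2, K)}
    (hγ : γ • Disc.mk P.1 P.2 = Disc.mk P.1 P.2) (x y : P1 K) :
    chordal P (γ • x) (γ • y) = chordal P x y := by
  induction γ using Matrix.ProjGenLinGroup.induction_on with | mk g =>
  induction x using Projectivization.ind with | _ u hu =>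
  induction y using Projectivization.ind with | _ w hw =>
  obtain ⟨c, hc, h⟩ := (smul_mk_eq_iff g P).1 hγ
  have h1 := discNorm_pos P hu
  have h2 := discNorm_pos P hw
  rw [Projectivization.PGL.mk_smul_mk, Projectivization.PGL.mk_smul_mk, chordal_mk, chordal_mk]
  change ‖cross (g.val.mulVec u) (g.val.mulVec w)‖ /
    (discNorm P (g.val.mulVec u) * discNorm P (g.val.mulVec w)) = _
  rw [h, h, cross_mulVec, norm_mul, norm_det_of_similitude P g hc h]
  field_simp

/-- The chordal balls are small in the quotient topology: the point `[w]` is reached from `[u]`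
along the curve `t ↦ [u + t v]`, with a parameter `t` controlled by the chordal distance. -/
lemma exists_chordal_lt_subset (P : PreDisc K) {U : Set (P1 K)} (hU : IsOpen U) {x : P1 K}
    (hx : x ∈ U) : ∃ ε > 0, ∀ y, chordal P x y < ε → y ∈ U := by
  induction x using Projectivization.ind with | _ u hu =>
  obtain ⟨v, hv⟩ := exists_cross_ne_zero hu
  have hline : ∀ t : K, u + t • v ≠ 0 := fun t h => hv (by
    have h0 := congrFun h 0
    have h1 := congrFun h 1
    simp only [Pi.add_apply, Pi.smul_apply, smul_eq_mul, Pi.zero_apply] at h0 h1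
    simp only [cross]
    linear_combination v 1 * h0 - v 0 * h1)
  let f : K → {w : Fin 2 → K // w ≠ 0} := fun t => ⟨u + t • v, hline t⟩
  have hf : Continuous f := by fun_prop
  have hopen : IsOpen (f ⁻¹' (Projectivization.mk' K ⁻¹' U)) :=
    (isOpen_coinduced.1 hU).preimage hf
  have h0 : (0 : K) ∈ f ⁻¹' (Projectivization.mk' K ⁻¹' U) := by
    change Projectivization.mk K (u + (0 : K) • v) _ ∈ U
    simpa using hx
  obtain ⟨δ, hδ, hball⟩ := Metric.isOpen_iff.1 hopen 0 h0
  have hNu := discNorm_pos P hu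
  have hv0 : v ≠ 0 := by rintro rfl; simp [cross] at hv
  have hNv := discNorm_pos P hv0
  have hc := norm_pos_iff.2 hv
  set d := ‖cross u v‖
  refine ⟨min (d / (discNorm P u * discNorm P v)) (δ * d / discNorm P u ^ 2), by positivity, ?_⟩
  intro y hy
  induction y using Projectivization.ind with | _ w hw =>
  have hNw := discNorm_pos P hw
  rw [chordal_mk, lt_min_iff, div_lt_div_iff₀ (by positivity) (by positivity),
    div_lt_div_iff₀ (by positivity) (by positivity)] at hy
  obtain ⟨hy1, hy2⟩ := hy
  have hw' := cross_smul_eq u v w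
  -- the first bound makes the `v`-component of `w` too small to carry its norm
  have hN : d * discNorm P w ≤ ‖cross w v‖ * discNorm P u := by
    have h := discNorm_add_le P (cross u w • v) (cross w v • u)
    rw [← hw', discNorm_smul, discNorm_smul, discNorm_smul] at h
    rcases le_max_iff.1 h with h | h
    · nlinarith
    · exact h
  have hα : 0 < ‖cross w v‖ := by
    by_contra! h
    nlinarith [mul_pos hc hNw]
  have ht : ‖cross u w / cross w v‖ < δ := by
    rw [norm_div, div_lt_iff₀ hα]
    have h1 : ‖cross u w‖ * discNorm P u ^ 2 < δ * ‖cross w v‖ * discNorm P u ^ 2 := by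
      refine hy2.trans_le ?_
      nlinarith [mul_le_mul_of_nonneg_left hN (mul_pos hδ hNu).le]
    exact lt_of_mul_lt_mul_right h1 (by positivity)
  have hmem : Projectivization.mk K (u + (cross u w / cross w v) • v) (hline _) ∈ U :=
    hball (by simpa using ht)
  convert hmem using 1
  rw [Projectivization.mk_eq_mk_iff']
  refine ⟨cross w v / cross u v, ?_⟩
  have hα0 := norm_pos_iff.1 hα
  ext i
  have hi := congrFun hw' i
  simp only [Pi.add_apply, Pi.smul_apply, smul_eq_mul] at hi ⊢
  field_simp
  linear_combination -hi

end Ultrametric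

/-! ### Stabilizers of balls in discontinuous groups -/

section Recurrence

variable {K : Type*} [NormedField K]

lemma IsDiscontinuous.mono {G Γ : Subgroup PGL(2, K)} (hG : IsDiscontinuous G) (h : Γ ≤ G) :
    IsDiscontinuous Γ := by
  refine ⟨hG.1.mono ?_, fun x => (hG.2 x).of_isClosed_subset isClosed_closure (closure_mono ?_)⟩
  · rintro x hx ⟨γ, hinj, hγ, hlim⟩
    exact hx ⟨γ, hinj, fun n => h (hγ n), hlim⟩
  · rintro y ⟨g, hg, rfl⟩
    exact ⟨g, h hg, rfl⟩

variable [IsUltrametricDist K]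

/-- An element that stabilizes a ball acts by isometries of a chordal distance, so it is recurrent
on every orbit with compact closure. -/
lemma exists_pow_chordal_lt {G : Subgroup PGL(2, K)} {P : PreDisc K} {γ : PGL(2, K)} (hγG : γ ∈ G)
    (hγ : γ • Disc.mk P.1 P.2 = Disc.mk P.1 P.2) {x : P1 K}
    (hx : IsCompact (closure {y | ∃ g ∈ G, y = g • x})) {ε : ℝ} (hε : 0 < ε) :
    ∃ k, 0 < k ∧ chordal P x (γ ^ k • x) < ε := by
  obtain ⟨t, ht⟩ := hx.elim_finite_subcover (fun z : P1 K => {y | chordal P z y < ε})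
    (fun z => isOpen_chordal_lt P z ε)
    (fun z _ => Set.mem_iUnion.2 ⟨z, by simpa [chordal_self] using hε⟩)
  have hcov : ∀ n : ℕ, ∃ z : t, chordal P z (γ ^ n • x) < ε := fun n => by
    have := ht (subset_closure ⟨γ ^ n, G.pow_mem hγG n, rfl⟩)
    simpa using this
  choose f hf using hcov
  obtain ⟨n, m, hnm, hfeq⟩ := Finite.exists_ne_map_eq_of_infinite f
  wlog hlt : n < m generalizing n m
  · exact this m n hnm.symm hfeq.symm (by omega)
  refine ⟨m - n, by omega, ?_⟩
  have hpow : γ ^ n • Disc.mk P.1 P.2 = Disc.mk P.1 P.2 :=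
    (MulAction.stabilizer PGL(2, K) (Disc.mk P.1 P.2)).pow_mem hγ n
  rw [← chordal_smul_smul hpow, ← mul_smul, ← pow_add, Nat.add_sub_cancel' hlt.le]
  refine (chordal_le_max P (f n) _ _).trans_lt (max_lt (hf n) ?_)
  rw [hfeq]
  exact hf m

/-- The elements of a discontinuous group that stabilize a ball have finite order: otherwise every
point is a limit of its images under powers of such an element. -/
theorem IsDiscontinuous.isOfFinOrder_of_smul_eq {G : Subgroup PGL(2, K)} (hG : IsDiscontinuous G)
    {γ : PGL(2, K)} (hγG : γ ∈ G) {D : Disc K} (hγ : γ • D = D) : IsOfFinOrder γ := by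
  obtain ⟨⟨x, hx⟩, hcpt⟩ := hG
  induction D using Quotient.inductionOn with | _ P =>
  change γ • Disc.mk P.1 P.2 = Disc.mk P.1 P.2 at hγ
  by_contra hfin
  have hinj := injective_pow_iff_not_isOfFinOrder.2 hfin
  obtain ⟨φ, hφ, hφx⟩ := Filter.extraction_forall_of_frequently
    (P := fun n k => chordal P x (γ ^ k • x) < 1 / ((n : ℝ) + 1)) (fun n => by
      rw [Filter.frequently_atTop]
      intro N
      -- recurrence for `γ ^ (N + 1)` gives an exponent that is at least `N`
      obtain ⟨k, hk, hlt⟩ := exists_pow_chordal_lt (G.pow_mem hγG (N + 1))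
        ((MulAction.stabilizer PGL(2, K) (Disc.mk P.1 P.2)).pow_mem hγ (N + 1)) (hcpt x)
        (ε := 1 / ((n : ℝ) + 1)) (by positivity)
      rw [← pow_mul] at hlt
      exact ⟨(N + 1) * k, by nlinarith, hlt⟩)
  refine hx ⟨fun n => γ ^ φ n, hinj.comp hφ.injective, fun n => G.pow_mem hγG _, x, ?_⟩
  rw [tendsto_nhds]
  intro U hU hxU
  obtain ⟨ε, hε, hsub⟩ := exists_chordal_lt_subset P hU hxU
  filter_upwards [tendsto_one_div_add_atTop_nhds_zero_nat.eventually_lt_const hε] with n hn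
  exact hsub _ ((hφx n).trans hn)

end Recurrence

/-! ### Elements of finite order are elliptic -/

section Torsion

/-- A root of the characteristic polynomial of a `2 × 2` matrix has an eigenvector. -/
lemma exists_eigenvector_of_trace_of_det {K : Type*} [Field K] {A : Matrix (Fin 2) (Fin 2) K}
    {a b : K} (ht : A.trace = a + b) (hd : A.det = a * b) :
    ∃ u : Fin 2 → K, u ≠ 0 ∧ A.mulVec u = a • u := by
  have h : (A - Matrix.scalar (Fin 2) a).det = 0 := by
    rw [Matrix.trace_fin_two] at ht
    rw [Matrix.det_fin_two] at hd ⊢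
    simp
    linear_combination hd - a * ht
  obtain ⟨u, hu, h0⟩ := Matrix.exists_mulVec_eq_zero_iff.2 h
  refine ⟨u, hu, ?_⟩
  rw [Matrix.sub_mulVec, sub_eq_zero] at h0
  rw [h0]
  ext i
  simp

lemma pow_mulVec_of_eigenvector {K : Type*} [Field K] {A : Matrix (Fin 2) (Fin 2) K}
    {a : K} {u : Fin 2 → K} (h : A.mulVec u = a • u) (n : ℕ) :
    (A ^ n).mulVec u = a ^ n • u := by
  induction n with
  | zero => simp
  | succ n ih => rw [pow_succ', ← Matrix.mulVec_mulVec, ih, Matrix.mulVec_smul, h,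
      smul_smul, pow_succ]

/-- In characteristic zero a matrix with a double eigenvalue has a scalar power only if it is
scalar itself. -/
lemma eq_scalar_of_pow_eq_scalar {K : Type*} [Field K] [CharZero K]
    {A : Matrix (Fin 2) (Fin 2) K} {a c : K} (ht : A.trace = a + a) (hd : A.det = a * a)
    (ha : a ≠ 0) {n : ℕ} (hn : 0 < n) (hA : A ^ n = Matrix.scalar (Fin 2) c) :
    A = Matrix.scalar (Fin 2) a := by
  -- by Cayley-Hamilton the difference `B` has square zero, so that `A ^ n` is linear in `B`
  set B := A - Matrix.scalar (Fin 2) a with hB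
  have hAB : A = Matrix.scalar (Fin 2) a + B := by rw [hB]; abel
  have hBB : B * B = 0 := by
    rw [Matrix.trace_fin_two] at ht
    rw [Matrix.det_fin_two] at hd
    ext i j
    fin_cases i <;> fin_cases j <;> simp [hB, Matrix.mul_apply, Fin.sum_univ_two]
    · linear_combination A 0 0 * ht - hd
    · linear_combination A 0 1 * ht
    · linear_combination A 1 0 * ht
    · linear_combination A 1 1 * ht - hd
  have hpow : ∀ m : ℕ, A ^ (m + 1) =
      Matrix.scalar (Fin 2) (a ^ (m + 1)) + ((m + 1 : K) * a ^ m) • B := by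
    intro m
    induction m with
    | zero => simpa using hAB
    | succ m ih =>
      rw [pow_succ, ih]
      conv_lhs => rw [hAB]
      rw [add_mul, mul_add, mul_add, Matrix.smul_mul, Matrix.smul_mul, hBB]
      ext i j
      fin_cases i <;> fin_cases j <;> simp <;> ring
  obtain ⟨m, rfl⟩ : ∃ m, n = m + 1 := ⟨n - 1, by omega⟩
  have hne : (m + 1 : K) * a ^ m ≠ 0 :=
    mul_ne_zero (by exact_mod_cast m.succ_ne_zero) (pow_ne_zero _ ha)
  have h := (hpow m).symm.trans hA
  have hentry : ∀ i j, (Matrix.scalar (Fin 2) (a ^ (m + 1))) i j + ((m + 1 : K) * a ^ m) * B i j =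
      (Matrix.scalar (Fin 2) c) i j := fun i j => by
    simpa using congrFun (congrFun h i) j
  have h01 : B 0 1 = 0 := by simpa [hne] using hentry 0 1
  have h10 : B 1 0 = 0 := by simpa [hne] using hentry 1 0
  have h00 : B 0 0 = 0 := by
    have := congrFun (congrFun hBB 0) 0
    simpa [Matrix.mul_apply, Fin.sum_univ_two, h01] using this
  have h11 : B 1 1 = 0 := by
    have := congrFun (congrFun hBB 1) 1
    simpa [Matrix.mul_apply, Fin.sum_univ_two, h10] using this
  rw [← sub_eq_zero]
  change B = 0
  ext i j
  fin_cases i <;> fin_cases j <;> assumption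

/-- A non-trivial element of finite order of `PGL₂` has two different eigenvalues, of the same
absolute value since their quotient is a root of unity. -/
lemma exists_eigenvalues_of_isOfFinOrder {K : Type*} [NormedField K] [CharZero K] [IsAlgClosed K]
    {g : GL (Fin 2) K} (hfin : IsOfFinOrder (Matrix.ProjGenLinGroup.mk g))
    (hne : Matrix.ProjGenLinGroup.mk g ≠ 1) :
    ∃ a b : K, a ≠ b ∧ ‖a‖ = ‖b‖ ∧ g.val.trace = a + b ∧ g.val.det = a * b := by
  obtain ⟨n, hn, hpow⟩ := isOfFinOrder_iff_pow_eq_one.1 hfin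
  rw [← map_pow, Matrix.ProjGenLinGroup.mk_eq_one,
    Matrix.GeneralLinearGroup.center_eq_range_scalar] at hpow
  obtain ⟨c, hc⟩ := hpow
  have hA : g.val ^ n = Matrix.scalar (Fin 2) (c : K) := by
    rw [← Units.val_pow_eq_pow_val, ← hc]; rfl
  -- a root `a` of the characteristic polynomial; the other one is `trace - a`
  obtain ⟨a, ha⟩ := IsAlgClosed.exists_eval₂_eq_zero (RingHom.id K)
    (Polynomial.X ^ 2 - Polynomial.C g.val.trace * Polynomial.X + Polynomial.C g.val.det)
    (by
      have : (Polynomial.X ^ 2 - Polynomial.C g.val.trace * Polynomial.X +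
        Polynomial.C g.val.det).degree = 2 := by compute_degree!
      rw [this]; norm_num)
  simp at ha
  obtain ⟨b, hb⟩ : ∃ b, b = g.val.trace - a := ⟨_, rfl⟩
  have ht : g.val.trace = a + b := by rw [hb]; ring
  have hd : g.val.det = a * b := by rw [hb]; linear_combination ha
  have hpow_eq : ∀ {x y : K}, g.val.trace = x + y → g.val.det = x * y → x ^ n = c := by
    intro x y h1 h2
    obtain ⟨u, hu, hxu⟩ := exists_eigenvector_of_trace_of_det h1 h2
    have h3 := pow_mulVec_of_eigenvector hxu n
    rw [hA] at h3
    have h4 : (Matrix.scalar (Fin 2) (c : K)).mulVec u = (c : K) • u := by ext i; simp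
    exact (smul_left_injective K hu (h4.symm.trans h3)).symm
  refine ⟨a, b, ?_, ?_, ht, hd⟩
  · rintro hab
    rw [← hab] at ht hd
    have ha0 : a ≠ 0 := by
      rintro rfl
      exact g.det_ne_zero (by simpa using hd)
    have h := eq_scalar_of_pow_eq_scalar ht hd ha0 hn hA
    refine hne ?_
    have : g = Matrix.GeneralLinearGroup.scalar (Fin 2) (Units.mk0 a ha0) := Units.ext h
    rw [this, Matrix.ProjGenLinGroup.mk_scalar]
  · have h : ‖a‖ ^ n = ‖b‖ ^ n := by
      rw [← norm_pow, ← norm_pow, hpow_eq ht hd,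
        hpow_eq (ht.trans (add_comm _ _)) (hd.trans (mul_comm _ _))]
    exact (pow_left_inj₀ (norm_nonneg _) (norm_nonneg _) hn.ne').1 h

end Torsion

/-! ### Elliptic elements fix a vertex between their fixed points -/

section Elliptic

variable {K : Type*} [NormedField K]

lemma eq_affinePt_or_inftyPt_of_mem_rationalPts {k : Subfield K} {x : P1 K}
    (hx : x ∈ rationalPts k) : (∃ s ∈ k, x = affinePt s) ∨ x = inftyPt := by
  obtain ⟨w, hw, hk, rfl⟩ := hx
  by_cases h1 : w 1 = 0
  · right
    rw [inftyPt, Projectivization.mk_eq_mk_iff']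
    refine ⟨w 0, ?_⟩
    ext i
    fin_cases i <;> simp [h1]
  · left
    refine ⟨w 0 / w 1, k.div_mem (hk 0) (hk 1), ?_⟩
    rw [affinePt, Projectivization.mk_eq_mk_iff']
    refine ⟨w 1, ?_⟩
    ext i
    fin_cases i <;> simp [mul_div_cancel₀ _ h1]

lemma mulVec_eq_smul_of_mk_eq {A : Matrix (Fin 2) (Fin 2) K} {a : K} {u v : Fin 2 → K}
    {hu : u ≠ 0} {hv : v ≠ 0} (h : A.mulVec u = a • u)
    (huv : Projectivization.mk K u hu = Projectivization.mk K v hv) : A.mulVec v = a • v := by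
  obtain ⟨c, rfl⟩ := (Projectivization.mk_eq_mk_iff' K v u hv hu).1 huv.symm
  rw [Matrix.mulVec_smul, h, smul_comm]

lemma discNorm_affine_add_infty (s : K) (α β : K) :
    discNorm (s, ⟨1, one_pos⟩) (α • ![s, 1] + β • ![1, 0]) =
      max (‖α‖ * discNorm (s, ⟨1, one_pos⟩) ![s, 1])
        (‖β‖ * discNorm (s, ⟨1, one_pos⟩) ![1, 0]) := by
  simp [discNorm, mul_comm, max_comm]

variable [IsUltrametricDist K]

/-- A matrix with eigenvalues of the same absolute value stabilizes a ball for whose norm the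
eigenvectors are orthogonal in the ultrametric sense. -/
lemma smul_mk_eq_of_orthogonal {P : PreDisc K} {g : GL (Fin 2) K} {a b : K} {u v : Fin 2 → K}
    (ha : a ≠ 0) (hab : ‖a‖ = ‖b‖) (hu : g.val.mulVec u = a • u) (hv : g.val.mulVec v = b • v)
    (huv : cross u v ≠ 0)
    (horth : ∀ α β : K,
      discNorm P (α • u + β • v) = max (‖α‖ * discNorm P u) (‖β‖ * discNorm P v)) :
    Matrix.ProjGenLinGroup.mk g • Disc.mk P.1 P.2 = Disc.mk P.1 P.2 := by
  rw [smul_mk_eq_iff]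
  refine ⟨‖a‖, norm_pos_iff.2 ha, fun w => ?_⟩
  have hw : w = (cross w v / cross u v) • u + (cross u w / cross u v) • v := by
    have h := cross_smul_eq u v w
    ext i
    have hi := congrFun h i
    simp only [Pi.add_apply, Pi.smul_apply, smul_eq_mul] at hi ⊢
    field_simp
    linear_combination hi
  rw [hw, Matrix.mulVec_add, Matrix.mulVec_smul, Matrix.mulVec_smul, hu, hv, smul_smul, smul_smul,
    horth, horth, norm_mul, norm_mul, ← hab, mul_max_of_nonneg _ _ (norm_nonneg a)]
  congr 1 <;> ring

/-- For the norm of the smallest ball that contains `s` and `t`, the vectors `(s, 1)` and `(t, 1)`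
are orthogonal in the ultrametric sense. -/
lemma discNorm_affine_add_affine {s t : K} (hst : 0 < ‖s - t‖) (α β : K) :
    discNorm (s, ⟨‖s - t‖, hst⟩) (α • ![s, 1] + β • ![t, 1]) =
      max (‖α‖ * discNorm (s, ⟨‖s - t‖, hst⟩) ![s, 1])
        (‖β‖ * discNorm (s, ⟨‖s - t‖, hst⟩) ![t, 1]) := by
  simp only [discNorm, Pi.add_apply, Pi.smul_apply, smul_eq_mul, Matrix.cons_val_zero,
    Matrix.cons_val_one, mul_one, sub_self, norm_zero, norm_one, norm_sub_rev t s, max_self,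
    max_eq_right hst.le]
  rw [show α * s + β * t - s * (α + β) = β * (t - s) by ring, norm_mul, norm_sub_rev t s,
    mul_comm ‖β‖, add_comm α β, max_shift hst.le le_rfl, max_comm, mul_comm ‖α‖]

lemma disc_mem_bruhatTitsVertices {k : Subfield K} {s c : K} (hs : s ∈ k) (hc : c ∈ k)
    (hpos : 0 < ‖c‖) : Disc.mk s ⟨‖c‖, hpos⟩ ∈ bruhatTitsVertices k :=
  ⟨⟨hpos, c ^ 2, k.pow_mem hc 2, pow_ne_zero 2 (norm_pos_iff.1 hpos), (norm_pow c 2).symm⟩,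
    s, hs, ⟨_, rfl⟩⟩

/-- An elliptic element with rational fixed points stabilizes a vertex of the Bruhat-Tits tree on
the line that joins them. -/
lemma exists_mem_line_smul_eq {k : Subfield K} {g : GL (Fin 2) K} {a b : K} (hne : a ≠ b)
    (hab : ‖a‖ = ‖b‖) (ht : g.val.trace = a + b) (hd : g.val.det = a * b)
    (hk : fixedPts (Matrix.ProjGenLinGroup.mk g) ⊆ rationalPts k) :
    ∃ x ∈ fixedPts (Matrix.ProjGenLinGroup.mk g), ∃ y ∈ fixedPts (Matrix.ProjGenLinGroup.mk g),
      x ≠ y ∧ ∃ D ∈ bruhatTitsVertices k, D ∈ line x y ∧ Matrix.ProjGenLinGroup.mk g • D = D := by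
  have hd0 := g.det_ne_zero
  rw [hd] at hd0
  obtain ⟨ha, hb⟩ := mul_ne_zero_iff.1 hd0
  obtain ⟨u, hu, hau⟩ := exists_eigenvector_of_trace_of_det ht hd
  obtain ⟨v, hv, hbv⟩ := exists_eigenvector_of_trace_of_det (ht.trans (add_comm _ _))
    (hd.trans (mul_comm _ _))
  have hfix : ∀ {c : K} {w : Fin 2 → K} (hw : w ≠ 0), g.val.mulVec w = c • w →
      Projectivization.mk K w hw ∈ fixedPts (Matrix.ProjGenLinGroup.mk g) := by
    intro c w hw h
    change Matrix.ProjGenLinGroup.mk g • _ = _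
    rw [Projectivization.PGL.mk_smul_mk, Projectivization.mk_eq_mk_iff']
    exact ⟨c, h.symm⟩
  have hx := hfix hu hau
  have hy := hfix hv hbv
  have hxy : Projectivization.mk K u hu ≠ Projectivization.mk K v hv := fun h => by
    have h1 := mulVec_eq_smul_of_mk_eq hau h
    exact hne (smul_left_injective K hv (h1.symm.trans hbv))
  refine ⟨_, hx, _, hy, hxy, ?_⟩
  rcases eq_affinePt_or_inftyPt_of_mem_rationalPts (hk hx) with ⟨s, hs, hxs⟩ | hxs <;>
    rcases eq_affinePt_or_inftyPt_of_mem_rationalPts (hk hy) with ⟨t, hts, hyt⟩ | hyt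
  · have hst : s - t ≠ 0 := fun h => hxy (by rw [hxs, hyt, sub_eq_zero.1 h])
    have hpos := norm_pos_iff.2 hst
    refine ⟨_, disc_mem_bruhatTitsVertices hs (k.sub_mem hs hts) hpos,
      Or.inl ⟨s, t, hxs, hyt, Or.inl ⟨_, rfl⟩, le_rfl⟩, ?_⟩
    exact smul_mk_eq_of_orthogonal (P := (s, ⟨‖s - t‖, hpos⟩)) ha hab
      (mulVec_eq_smul_of_mk_eq hau hxs) (mulVec_eq_smul_of_mk_eq hbv hyt)
      (by simpa [cross] using hst) (discNorm_affine_add_affine hpos)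
  · refine ⟨Disc.mk s ⟨1, one_pos⟩, by
      simpa using disc_mem_bruhatTitsVertices hs k.one_mem (by simp),
      Or.inr ⟨s, Or.inl ⟨hxs, hyt⟩, ⟨_, rfl⟩⟩, ?_⟩
    exact smul_mk_eq_of_orthogonal (P := (s, ⟨1, one_pos⟩)) ha hab
      (mulVec_eq_smul_of_mk_eq hau hxs) (mulVec_eq_smul_of_mk_eq hbv hyt)
      (by simp [cross]) (discNorm_affine_add_infty s)
  · refine ⟨Disc.mk t ⟨1, one_pos⟩, by
      simpa using disc_mem_bruhatTitsVertices hts k.one_mem (by simp),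
      Or.inr ⟨t, Or.inr ⟨hxs, hyt⟩, ⟨_, rfl⟩⟩, ?_⟩
    exact smul_mk_eq_of_orthogonal (P := (t, ⟨1, one_pos⟩)) hb hab.symm
      (mulVec_eq_smul_of_mk_eq hbv hyt) (mulVec_eq_smul_of_mk_eq hau hxs)
      (by simp [cross]) (discNorm_affine_add_infty t)
  · exact absurd (hxs.trans hyt.symm) hxy

/-- A non-trivial element of finite order fixes a vertex of `T*(G)`. -/
theorem exists_mem_verts_smul_eq_of_isOfFinOrder [CharZero K] [IsAlgClosed K] {k : Subfield K}
    {G : Subgroup PGL(2, K)} (hk : IsFieldOfDefinition k G) {γ : PGL(2, K)} (hγ : γ ∈ G)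
    (hne : γ ≠ 1) (hfin : IsOfFinOrder γ) :
    ∃ D ∈ (fixedPointTree k G).verts, γ • D = D := by
  induction γ using Matrix.ProjGenLinGroup.induction_on with | mk g =>
  obtain ⟨a, b, hab, hnorm, ht, hd⟩ := exists_eigenvalues_of_isOfFinOrder hfin hne
  obtain ⟨x, hx, y, hy, hxy, D, hD, hline, hfix⟩ := exists_mem_line_smul_eq hab hnorm ht hd
    (hk.2 _ hγ ⟨g, rfl, a, b, hab, hnorm, ht, hd⟩)
  exact ⟨D, ⟨hD, x, ⟨_, hγ, hne, hx⟩, y, ⟨_, hγ, hne, hy⟩, hxy, hline⟩, hfix⟩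

end Elliptic

end PadicSchottky

theorem mainTheorem3 (p : ℕ) [Fact p.Prime]
    (G Γ : Subgroup PGL(2, ℂ_[p]))
    (hG : PadicSchottky.IsDiscontinuous G) (hGfg : G.FG)
    (hle : Γ ≤ G) (hnormal : (Γ.subgroupOf G).Normal) (hindex : (Γ.subgroupOf G).FiniteIndex)
    (k : IntermediateField ℚ_[p] ℂ_[p])
    (hk : PadicSchottky.IsFieldOfDefinition k.toSubfield G) :
    PadicSchottky.IsSchottky Γ ↔
      ∀ v : (PadicSchottky.quotientGraph k.toSubfield G).Vertex,
        ∀ Gv ∈ (PadicSchottky.quotientGraph k.toSubfield G).vertexGroups v, Γ ⊓ Gv = ⊥ := by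
  constructor
  · rintro ⟨-, -, htf⟩ v Gv ⟨D, -, -, rfl⟩
    refine (Subgroup.eq_bot_iff_forall _).2 ?_
    rintro γ ⟨hγΓ, hγG, hγD⟩
    exact htf γ hγΓ (hG.isOfFinOrder_of_smul_eq hγG hγD)
  · intro h
    refine ⟨hG.mono hle, ?_, fun γ hγ hfin => ?_⟩
    · have : Group.FG G := (Group.fg_iff_subgroup_fg G).2 hGfg
      have hfg : Group.FG (Γ.subgroupOf G) := Subgroup.fg_of_index_ne_zero _
      rw [← Group.fg_iff_subgroup_fg]
      exact Group.fg_of_surjective (f := (Subgroup.subgroupOfEquivOfLe hle).toMonoidHom)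
        (Subgroup.subgroupOfEquivOfLe hle).surjective
    · by_contra hne
      have : CharZero ℂ_[p] := algebraRat.charZero _
      obtain ⟨D, hD, hfix⟩ :=
        PadicSchottky.exists_mem_verts_smul_eq_of_isOfFinOrder hk (hle hγ) hne hfin
      have hbot := h ⟨Quotient.mk _ D, D, hD, rfl⟩ _ ⟨D, hD, rfl, rfl⟩
      exact hne ((Subgroup.eq_bot_iff_forall _).1 hbot γ ⟨hγ, hle hγ, hfix⟩)
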